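/- Lemma 2 (delay). Consider the following algorithm. Its input is an integer $k\ge 1$ and a finite connected simple graph $G=(V,E)$ with at least two vertices and maximum degree $\Delta$, given by adjacency lists (each in an arbitrary order) and with $V$ stored in the discovery order of an arbitrary depth-first traversal. It keeps global lists $S,N,F,T$, initially empty and modified only at their ends, and two Boolean arrays indexed by $V$, initially false, recording membership in $S\cup N\cup F$ and in $T$. Main: for each $v\in V$, from the back of $V$ to the front: set $S=\{v\}$; append the $\ell$ vertices of $N(v)\setminus F$ to $F$; call Enumerate$(\ell)$; append $v$ to $F$; restore $S$ and $N$ (to empty); stop if $|V|-|F|<k$. Enumerate$(\ell)$: set hasSolution to False. If $|S|=k$, output $S$ and return True. Otherwise, if $|S|+|T|=k$, output $S\cup T$, empty $T$ and set hasSolution to True. Then, $\ell$ times: remove the last vertex $u$ of $F$ and append it to $S$; put $\ell'=0$; if $|S|<k$, then for each $w\in N(u)\setminus(S\cup N\cup F)$ append $w$ to $N$ if $w\in T$, and otherwise append $w$ to $F$ and increase $\ell'$ by one; if moreover $|S|<k$ and hasSolution is True, increase $\ell'$ by $|N|$ and move the vertices of $N$, one by one from its end, to the end of $F$; call Enumerate$(\ell')$;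 if it returns True, set hasSolution to True, otherwise append $u$ to $T$; remove $u$ from $S$, remove from the end of $N$ as many vertices as lie outside the former $S\cup N\cup F$ and were treated in this iteration, and append $u$ to $N$. Finally return hasSolution. Time is counted as the number of elementary operations: each append to or removal from the end of a list, each size query, each read or write of an entry of a Boolean array, each loop iteration and each procedure call costs one unit, and outputting a set $X$ costs $|X|$ units; the computation of the depth-first order and the initialization of the arrays precede the run and are not counted. Then the delay of the algorithm is $O(k\Delta)$: there is an absolute constant $C$ such that, for all such inputs, the time from the start of Main to the first output, and the time between any two consecutive outputs, is at most $C\,k\,\Delta$. -/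

import Mathlib

namespace ConnEnum

/-! ### Input: adjacency lists and depth-first search orders -/

/-- `adj` is an adjacency-list representation of `G`: `adj v` lists the neighbour set `N(v)` in some
order, without repetition. -/
structure IsAdjacencyLists {V : Type*} (G : SimpleGraph V) (adj : V → List V) : Prop where
  nodup : ∀ v, (adj v).Nodup
  mem_iff : ∀ v w, w ∈ adj v ↔ G.Adj v w

/-- `DFSReaches G stack found`: some depth-first traversal of `G` can reach the situation in which
`stack` is the current search path (its top vertex first) and `found` lists the vertices discovered
so far in the order of their discovery times. -/
inductive DFSReaches {V : Type*} (G : SimpleGraph V) : List V → List V → Prop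
  | root (r : V) : DFSReaches G [r] [r]
  | discover {u w : V} {stack found : List V} :
      DFSReaches G (u :: stack) found → G.Adj u w → w ∉ found →
        DFSReaches G (w :: u :: stack) (found ++ [w])
  | retreat {u : V} {stack found : List V} :
      DFSReaches G (u :: stack) found → (∀ w, G.Adj u w → w ∈ found) →
        DFSReaches G stack found

/-- `order` lists all the vertices of `G` in the discovery order of a complete depth-first
traversal. -/
def IsDFSOrder {V : Type*} (G : SimpleGraph V) (order : List V) : Prop :=
  DFSReaches G [] order ∧ ∀ v, v ∈ order

/-! ### The machine: global memory, unit-cost operations, and the trace of a run -/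

/-- What an observer of a run sees: a unit of time passes, or a solution is output. -/
inductive Event (V : Type)
  | tick : Event V
  | output (X : List V) : Event V

/-- The global memory. `S`, `N`, `F`, `T` are resizable arrays that are changed only at their end;
they are represented as lists whose head is the END of the array. `inSNF` and `inT` are Boolean
arrays indexed by the vertices, which record membership in `S ∪ N ∪ F` and in `T`. `trace` is the
chronological record of the run and is never read by the program. -/
structure Mem (V : Type) where
  S : List V
  N : List V
  F : List V
  T : List V
  inSNF : V → Bool
  inT : V → Bool
  trace : List (Event V)

/-- The initial memory: all arrays empty, respectively constantly false. -/
def Mem.init (V : Type) : Mem V := ⟨[], [], [], [], fun _ => false, fun _ => false, []⟩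

/-- Programs that act on the global memory and return a value. -/
abbrev Prog (V : Type) := StateM (Mem V)

section Operations

variable {V : Type}

/-- One unit of time passes. Besides every operation below, also every procedure call and every loop
iteration is charged a unit; this pays for the boundedly many operations on local variables. -/
def tick : Prog V Unit := modify fun m => { m with trace := m.trace ++ [Event.tick] }

/-- Output the vertices of `X`; one unit of time per vertex written. -/
def output (X : List V) : Prog V Unit :=
  modify fun m =>
    { m with trace := m.trace ++ List.replicate X.length Event.tick ++ [Event.output X] }

/-- The number of elements of `S` (a resizable array knows its size). -/
def sizeS : Prog V ℕ := do tick; return (← get).S.length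
/-- The number of elements of `N`. -/
def sizeN : Prog V ℕ := do tick; return (← get).N.length
/-- The number of elements of `F`. -/
def sizeF : Prog V ℕ := do tick; return (← get).F.length
/-- The number of elements of `T`. -/
def sizeT : Prog V ℕ := do tick; return (← get).T.length

/-- Append `v` to the end of `S`. -/
def pushS (v : V) : Prog V Unit := do tick; modify fun m => { m with S := v :: m.S }
/-- Append `v` to the end of `N`. -/
def pushN (v : V) : Prog V Unit := do tick; modify fun m => { m with N := v :: m.N }
/-- Append `v` to the end of `F`. -/
def pushF (v : V) : Prog V Unit := do tick; modify fun m => { m with F := v :: m.F }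
/-- Append `v` to the end of `T`. -/
def pushT (v : V) : Prog V Unit := do tick; modify fun m => { m with T := v :: m.T }

/-- Remove the last element of `S` and return it (`none` if `S` is empty). -/
def popS : Prog V (Option V) := do
  tick; let x := (← get).S.head?; modify fun m => { m with S := m.S.tail }; return x
/-- Remove the last element of `N` and return it (`none` if `N` is empty). -/
def popN : Prog V (Option V) := do
  tick; let x := (← get).N.head?; modify fun m => { m with N := m.N.tail }; return x
/-- Remove the last element of `F` and return it (`none` if `F` is empty). -/
def popF : Prog V (Option V) := do
  tick; let x := (← get).F.head?; modify fun m => { m with F := m.F.tail }; return x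
/-- Remove the last element of `T` and return it (`none` if `T` is empty). -/
def popT : Prog V (Option V) := do
  tick; let x := (← get).T.head?; modify fun m => { m with T := m.T.tail }; return x

/-- Read an entry of the Boolean array for `S ∪ N ∪ F`. -/
def readSNF (v : V) : Prog V Bool := do tick; return (← get).inSNF v
/-- Read an entry of the Boolean array for `T`. -/
def readT (v : V) : Prog V Bool := do tick; return (← get).inT v

variable [DecidableEq V]

/-- Write an entry of the Boolean array for `S ∪ N ∪ F`. -/
def writeSNF (v : V) (b : Bool) : Prog V Unit := do
  tick; modify fun m => { m with inSNF := Function.update m.inSNF v b }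
/-- Write an entry of the Boolean array for `T`. -/
def writeT (v : V) (b : Bool) : Prog V Unit := do
  tick; modify fun m => { m with inT := Function.update m.inT v b }

/-! ### The procedure `Enumerate` -/

/-- Remove the last `c` vertices of `T`, one by one. -/
def dropT : ℕ → Prog V Unit
  | 0 => pure ()
  | c + 1 => do
    tick
    match ← popT with
    | none => pure ()
    | some v => writeT v false
    dropT c

/-- Remove the last `c` vertices of `N`, one by one. -/
def dropN : ℕ → Prog V Unit
  | 0 => pure ()
  | c + 1 => do
    tick
    match ← popN with
    | none => pure ()
    | some v => writeSNF v false
    dropN c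

/-- Move the last `c` vertices of `N` to the end of `F`, one by one. -/
def moveNToF : ℕ → Prog V Unit
  | 0 => pure ()
  | c + 1 => do
    tick
    match ← popN with
    | none => pure ()
    | some w => pushF w
    moveNToF c

/-- Go through a list of vertices and treat those outside `S ∪ N ∪ F`: the ones in `T` are appended
to `N`, the others to `F`. Returns the number of vertices appended to `F` and the number of all
appended vertices. -/
def scan : List V → Prog V (ℕ × ℕ)
  | [] => pure (0, 0)
  | v :: vs => do
    tick
    if ← readSNF v then
      scan vs
    else
      writeSNF v true
      if ← readT v then
        pushN v
        let r ← scan vs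
        return (r.1, r.2 + 1)
      else
        pushF v
        let r ← scan vs
        return (r.1 + 1, r.2 + 1)

/-- Extend `N` and `F` after `u` has been appended to `S`: if `|S| < k`, the neighbours of `u` outside
`S ∪ N ∪ F` are treated by `scan`, and if a solution has been found before, then all of `N` is moved
to `F`. Returns the number `ℓ'` of open neighbours at the end of `F` for the recursive call, and the
number of newly added vertices, which is needed to restore `N` afterwards. -/
def expand (k : ℕ) (adj : V → List V) (u : V) (hasSolution : Bool) : Prog V (ℕ × ℕ) := do
  if (← sizeS) < k then
    let r ← scan (adj u)
    if hasSolution then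
      let c ← sizeN
      moveNToF c
      return (r.1 + c, r.2)
    else
      return r
  else
    return (0, 0)

/-- The main loop of `Enumerate`, which visits the last `ℓ` vertices of `F`. Here `call` is the
recursive call and `hasSolution` the current value of the flag; the final value is returned. At the
end of an iteration `N` is restored by removing as many vertices as the iteration has added to it,
directly or through the recursive call (which ends up appending to `N` all the open neighbours that
it was given). The case `none` does not occur. -/
def visitOpen (k : ℕ) (adj : V → List V) (call : ℕ → Prog V Bool) : ℕ → Bool → Prog V Bool
  | 0, hasSolution => pure hasSolution
  | ℓ + 1, hasSolution => do
    tick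
    match ← popF with
    | none => pure hasSolution
    | some u =>
      pushS u
      let r ← expand k adj u hasSolution
      let found ← call r.1
      if found then
        pure ()
      else
        pushT u
        writeT u true
      let _ ← popS
      dropN r.2
      pushN u
      visitOpen k adj call ℓ (hasSolution || found)

/-- `Enumerate(S, N, F, ℓ)`. The first argument bounds the depth of the recursion: `|S|` is larger
by one in a recursive call and a call with `|S| = k` makes no further call, so a call with `|S| ≥ 1`
has at most `k` nested calls, itself included, and the value `0` is not reached from `k`. -/
def enumerate (k : ℕ) (adj : V → List V) : ℕ → ℕ → Prog V Bool
  | 0, _ => pure false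
  | depth + 1, ℓ => do
    tick
    let s ← sizeS
    if s = k then
      output (← get).S
      return true
    else
      let t ← sizeT
      if s + t = k then
        output ((← get).S ++ (← get).T)
        dropT t
        visitOpen k adj (enumerate k adj depth) ℓ true
      else
        visitOpen k adj (enumerate k adj depth) ℓ false

/-! ### The procedure `Main` -/

/-- Append to `F` the vertices of a list that are not yet in `F` (when this is called, `N` is empty
and `S` consists of a vertex that is not in the list); returns their number. -/
def openAll : List V → Prog V ℕ
  | [] => pure 0
  | w :: ws => do
    tick
    if ← readSNF w then
      openAll ws
    else
      writeSNF w true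
      pushF w
      let r ← openAll ws
      return r + 1

/-- The loop of `Main` over the given vertices, in a graph with `n` vertices. Restoring `N` means to
empty it. -/
def mainLoop (k n : ℕ) (adj : V → List V) : List V → Prog V Unit
  | [] => pure ()
  | v :: vs => do
    tick
    pushS v
    writeSNF v true
    let ℓ ← openAll (adj v)
    let _ ← enumerate k adj k ℓ
    pushF v
    let _ ← popS
    dropN (← sizeN)
    if n - (← sizeF) < k then
      return ()
    else
      mainLoop k n adj vs

/-- The trace of the whole run on the graph with adjacency lists `adj`, whose vertices are stored in
the order `order` and visited from the back to the front. -/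
def runTrace (k : ℕ) (adj : V → List V) (order : List V) : List (Event V) :=
  (((mainLoop k order.length adj order.reverse).run (Mem.init V)).run).2.trace

end Operations

/-- The delay of a run is at most `d`: every stretch of the trace that begins at the start of the run
or immediately after an output, contains no output, and is immediately followed by an output, lasts
at most `d` units of time. -/
def DelayAtMost {V : Type} (d : ℕ) (trace : List (Event V)) : Prop :=
  ∀ (before gap after : List (Event V)) (X : List V),
    trace = before ++ gap ++ Event.output X :: after →
    (before = [] ∨ ∃ (start : List (Event V)) (Y : List V), before = start ++ [Event.output Y]) →
    (∀ e ∈ gap, e = Event.tick) →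
    gap.length ≤ d

end ConnEnum

namespace ConnEnum

/-! The proof is amortized: the list `T` serves as a bank account, each element of it being worth `K
= 8Δ + 20` units of time. A call that finds nothing leaves `T` longer, and the growth of `T` pays
for the time spent. Since `|S| + |T|` never passes `k` and equality forces an output, only about `K
* k` units can be spent before the next output.

Three costs need care. Unwinding the recursion after an output costs at most `K` per level, hence
the term `K * (k - s)` in the bound after success. Moving all of `N` to `F` costs `3 * |O|`, which
need not be `O(Δ)`. If the recursive call fails, its bound includes a credit of `3 * |O|`, collected
over the open vertices, that repays the move; if it succeeds, the clock has been reset. While the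
move is still unpaid, `|N| + |O| ≤ s * Δ` keeps it within `3 * k * Δ`. Finally, an iteration of
`Main` has overhead of its own. By the depth-first order every vertex except the root has a
neighbour visited later, so the call gets an open vertex and, if it fails, lengthens `T`; a second
`K` per element of `T` pays the overhead.

The recursion is handled by `visitOpen_step` and `enumerate_explores`, the outer loop by
`mainLoop_worst_le`, and the order by `DFSReaches.exists_adj_before`. -/

/-! ### Clocks -/

section Clock

variable {V : Type}

/-- The number of ticks since the last output, and the longest stretch that ended with an output. -/
def clock (tr : List (Event V)) : ℕ × ℕ :=
  tr.foldl (fun p e => match e with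
    | Event.tick => (p.1 + 1, p.2)
    | Event.output _ => (0, max p.2 p.1)) (0, 0)

/-- The number of ticks since the last output, or since the start if there is no output. -/
def lag (tr : List (Event V)) : ℕ := (clock tr).1

/-- The length of the longest stretch without output that ended with an output. -/
def worst (tr : List (Event V)) : ℕ := (clock tr).2

@[simp] theorem lag_nil : lag ([] : List (Event V)) = 0 := rfl

@[simp] theorem worst_nil : worst ([] : List (Event V)) = 0 := rfl

theorem lag_append_tick (tr : List (Event V)) : lag (tr ++ [Event.tick]) = lag tr + 1 := by
  simp [lag, clock]

theorem worst_append_tick (tr : List (Event V)) : worst (tr ++ [Event.tick]) = worst tr := by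
  simp [worst, clock]

@[simp] theorem lag_append_output (tr : List (Event V)) (X : List V) :
    lag (tr ++ [Event.output X]) = 0 := by
  simp [lag, clock]

@[simp] theorem worst_append_output (tr : List (Event V)) (X : List V) :
    worst (tr ++ [Event.output X]) = max (worst tr) (lag tr) := by
  simp [lag, worst, clock]

@[simp] theorem lag_append_ticks (tr : List (Event V)) (n : ℕ) :
    lag (tr ++ List.replicate n Event.tick) = lag tr + n := by
  induction n with
  | zero => simp
  | succ n ih => rw [List.replicate_succ', ← List.append_assoc, lag_append_tick, ih, add_assoc]

@[simp] theorem worst_append_ticks (tr : List (Event V)) (n : ℕ) :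
    worst (tr ++ List.replicate n Event.tick) = worst tr := by
  induction n with
  | zero => simp
  | succ n ih => rw [List.replicate_succ', ← List.append_assoc, worst_append_tick, ih]

theorem worst_le_worst_append (tr tr' : List (Event V)) : worst tr ≤ worst (tr ++ tr') := by
  induction tr' using List.reverseRecOn with
  | nil => simp
  | append_singleton tr' e ih =>
    rw [← List.append_assoc]
    cases e with
    | tick => rwa [worst_append_tick]
    | output X => exact ih.trans (by rw [worst_append_output]; exact le_max_left _ _)

/-- The clock stands at zero where a stretch begins, so it shows the length of the stretch when the
output comes; later events can only increase `worst`. -/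
theorem delayAtMost_of_worst_le {d : ℕ} {tr : List (Event V)} (h : worst tr ≤ d) :
    DelayAtMost d tr := by
  intro before gap after X htr hb hg
  have h0 : lag before = 0 := by
    rcases hb with rfl | ⟨start, Y, rfl⟩ <;> simp
  obtain ⟨n, rfl⟩ : ∃ n, gap = List.replicate n Event.tick :=
    ⟨_, List.eq_replicate_of_mem hg⟩
  have h1 := worst_le_worst_append (before ++ List.replicate n Event.tick ++ [Event.output X]) after
  rw [List.append_assoc _ [_], List.singleton_append, ← htr, worst_append_output,
    lag_append_ticks, h0, zero_add] at h1
  rw [List.length_replicate]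
  exact (le_max_right _ _).trans (h1.trans h)

/-- Consecutive blocks of ticks at the end of a trace merge. -/
theorem ticks_add (tr : List (Event V)) (a b : ℕ) :
    tr ++ (List.replicate a Event.tick ++ List.replicate b Event.tick) =
      tr ++ List.replicate (a + b) Event.tick := by
  rw [List.replicate_add]

end Clock

/-! ### Running the basic operations -/

section Run

variable {V : Type}

theorem run_bind {α β : Type} (p : Prog V α) (f : α → Prog V β) (m : Mem V) :
    (p >>= f).run m = (f (p.run m).1).run (p.run m).2 := rfl

theorem run_pure {α : Type} (a : α) (m : Mem V) : (pure a : Prog V α).run m = (a, m) := rfl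

theorem run_tick (m : Mem V) :
    tick.run m = ((), { m with trace := m.trace ++ [Event.tick] }) := rfl

theorem run_output (X : List V) (m : Mem V) :
    (output X).run m = ((), { m with
      trace := m.trace ++ List.replicate X.length Event.tick ++ [Event.output X] }) := rfl

theorem run_get (m : Mem V) : (get : Prog V (Mem V)).run m = (m, m) := rfl

theorem run_sizeS (m : Mem V) :
    sizeS.run m = (m.S.length, { m with trace := m.trace ++ [Event.tick] }) := rfl

theorem run_pushS (v : V) (m : Mem V) :
    (pushS v).run m = ((), { m with S := v :: m.S, trace := m.trace ++ [Event.tick] }) := rfl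

theorem run_popS (m : Mem V) :
    popS.run m =
      (m.S.head?, { m with S := m.S.tail, trace := m.trace ++ [Event.tick] }) := rfl

theorem run_sizeN (m : Mem V) :
    sizeN.run m = (m.N.length, { m with trace := m.trace ++ [Event.tick] }) := rfl

theorem run_pushN (v : V) (m : Mem V) :
    (pushN v).run m = ((), { m with N := v :: m.N, trace := m.trace ++ [Event.tick] }) := rfl

theorem run_sizeF (m : Mem V) :
    sizeF.run m = (m.F.length, { m with trace := m.trace ++ [Event.tick] }) := rfl

theorem run_pushF (v : V) (m : Mem V) :
    (pushF v).run m = ((), { m with F := v :: m.F, trace := m.trace ++ [Event.tick] }) := rfl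

theorem run_popF (m : Mem V) :
    popF.run m =
      (m.F.head?, { m with F := m.F.tail, trace := m.trace ++ [Event.tick] }) := rfl

theorem run_sizeT (m : Mem V) :
    sizeT.run m = (m.T.length, { m with trace := m.trace ++ [Event.tick] }) := rfl

theorem run_pushT (v : V) (m : Mem V) :
    (pushT v).run m = ((), { m with T := v :: m.T, trace := m.trace ++ [Event.tick] }) := rfl

theorem run_writeSNF [DecidableEq V] (v : V) (b : Bool) (m : Mem V) :
    (writeSNF v b).run m = ((), { m with
      inSNF := Function.update m.inSNF v b, trace := m.trace ++ [Event.tick] }) := rfl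

theorem run_writeT [DecidableEq V] (v : V) (b : Bool) (m : Mem V) :
    (writeT v b).run m = ((), { m with
      inT := Function.update m.inT v b, trace := m.trace ++ [Event.tick] }) := rfl

end Run

/-! ### The loops of the basic operations -/

section Loops

variable {V : Type}

theorem run_moveNToF (m : Mem V) :
    (moveNToF m.N.length).run m =
      ((), { m with
        N := []
        F := m.N.reverse ++ m.F
        trace := m.trace ++ List.replicate (3 * m.N.length) Event.tick }) := by
  obtain ⟨S, N, F, T, a, b, tr⟩ := m
  induction N generalizing F tr with
  | nil => simp [moveNToF]; rfl
  | cons v N ih =>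
    have hf := ih (v :: F) (tr ++ List.replicate 3 Event.tick)
    simp only [List.append_assoc, ticks_add] at hf
    simp [moveNToF, popN, tick, pushF]
    simp [List.replicate] at hf
    rw [show 3 * (N.length + 1) = 3 + 3 * N.length by ring, hf]

variable [DecidableEq V]

/-- The new array stays unspecified: the time analysis never needs `inT` to agree with `T`. -/
theorem run_dropT (m : Mem V) :
    ∃ f, (dropT m.T.length).run m =
      ((), { m with T := [], inT := f, trace := m.trace ++ List.replicate (3 * m.T.length) Event.tick }) := by
  obtain ⟨S, N, F, T, a, b, tr⟩ := m
  induction T generalizing b tr with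
  | nil => exact ⟨b, by simp [dropT]; rfl⟩
  | cons v T ih =>
    obtain ⟨f, hf⟩ := ih (Function.update b v false) (tr ++ List.replicate 3 Event.tick)
    refine ⟨f, ?_⟩
    simp only [List.append_assoc, ticks_add] at hf
    simp [dropT, popT, tick, writeT]
    simp [List.replicate] at hf
    rw [show 3 * (T.length + 1) = 3 + 3 * T.length by ring]
    exact hf

theorem run_dropN (X : List V) (m : Mem V) {Y : List V} (h : m.N = X ++ Y) :
    (dropN X.length).run m =
      ((), { m with
        N := Y
        inSNF := fun v => if v ∈ X then false else m.inSNF v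
        trace := m.trace ++ List.replicate (3 * X.length) Event.tick }) := by
  obtain ⟨S, N, F, T, a, b, tr⟩ := m
  simp only at h
  subst h
  induction X generalizing a tr with
  | nil => simp [dropN]; rfl
  | cons v X ih =>
    have hf := ih (Function.update a v false) (tr ++ List.replicate 3 Event.tick)
    simp only [List.append_assoc, ticks_add] at hf
    simp [dropN, popN, tick, writeSNF]
    simp [List.replicate] at hf
    rw [show 3 * (X.length + 1) = 3 + 3 * X.length by ring, hf]
    congr 2
    funext w
    by_cases hw : w = v <;> by_cases hX : w ∈ X <;> simp [hw, hX]

/-- Only the sizes matter, not which vertices go where. That all of them were unmarked is kept,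
because unmarking them later must restore the array. -/
theorem run_scan (L : List V) (m : Mem V) :
    ∃ (A B : List V) (n : ℕ), A.length + B.length ≤ L.length ∧ n ≤ 5 * L.length ∧
      (∀ v, v ∈ A ∨ v ∈ B → m.inSNF v = false) ∧
      (scan L).run m = ((A.length, A.length + B.length),
        { m with
          N := B ++ m.N
          F := A ++ m.F
          inSNF := fun v => if v ∈ A ∨ v ∈ B then true else m.inSNF v
          trace := m.trace ++ List.replicate n Event.tick }) := by
  obtain ⟨S, N, F, T, a, b, tr⟩ := m
  induction L generalizing N F a tr with
  | nil => exact ⟨[], [], 0, by simp, by simp, by simp, by simp [scan]; rfl⟩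
  | cons v L ih =>
    by_cases hv : a v
    · obtain ⟨A, B, n, hl, hn, hA, hf⟩ := ih N F a (tr ++ List.replicate 2 Event.tick)
      refine ⟨A, B, n + 2, by grind, by grind, hA, ?_⟩
      simp only [List.append_assoc, ticks_add] at hf
      simp [scan, readSNF, tick, hv]
      simp [List.replicate] at hf
      rw [hf, Nat.add_comm 2 n]
    · by_cases hT : b v
      · obtain ⟨A, B, n, hl, hn, hA, hf⟩ := ih (v :: N) F (Function.update a v true)
          (tr ++ List.replicate 5 Event.tick)
        have hA' : ∀ w, w ∈ A ∨ w ∈ B → w ≠ v := by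
          rintro w hw rfl
          simpa using hA w hw
        refine ⟨A, B ++ [v], n + 5, by grind, by grind, ?_, ?_⟩
        · intro w hw
          by_cases hwv : w = v
          · simpa [hwv] using hv
          · have := hA w (by simpa [hwv] using hw)
            simpa [hwv] using this
        · simp only [List.append_assoc, ticks_add] at hf
          simp [scan, readSNF, tick, hv, writeSNF, readT, hT, pushN]
          simp [List.replicate] at hf
          rw [hf, Nat.add_comm 5 n]
          refine Prod.ext (by simp [Functor.map]; omega) ?_
          simp [Functor.map]
          funext w
          by_cases hwv : w = v <;> simp [hwv]
      · obtain ⟨A, B, n, hl, hn, hA, hf⟩ := ih N (v :: F) (Function.update a v true)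
          (tr ++ List.replicate 5 Event.tick)
        refine ⟨A ++ [v], B, n + 5, by grind, by grind, ?_, ?_⟩
        · intro w hw
          by_cases hwv : w = v
          · simpa [hwv] using hv
          · have := hA w (by simpa [hwv] using hw)
            simpa [hwv] using this
        · simp only [List.append_assoc, ticks_add] at hf
          simp [scan, readSNF, tick, hv, writeSNF, readT, hT, pushF]
          simp [List.replicate] at hf
          rw [hf, Nat.add_comm 5 n]
          refine Prod.ext (by simp [Functor.map]; omega) ?_
          simp [Functor.map]
          funext w
          by_cases hwv : w = v <;> simp [hwv]

theorem run_openAll (L : List V) (m : Mem V) :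
    ∃ (A : List V) (n : ℕ), A.length ≤ L.length ∧ n ≤ 4 * L.length ∧
      (∀ v ∈ A, m.inSNF v = false) ∧ (∀ v ∈ L, m.inSNF v = false → v ∈ A) ∧
      (openAll L).run m = (A.length,
        { m with
          F := A ++ m.F
          inSNF := fun v => if v ∈ A then true else m.inSNF v
          trace := m.trace ++ List.replicate n Event.tick }) := by
  obtain ⟨S, N, F, T, a, b, tr⟩ := m
  induction L generalizing F a tr with
  | nil => exact ⟨[], 0, by simp, by simp, by simp, by simp, by simp [openAll]; rfl⟩
  | cons v L ih =>
    by_cases hv : a v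
    · obtain ⟨A, n, hl, hn, hA, hL, hf⟩ := ih F a (tr ++ List.replicate 2 Event.tick)
      refine ⟨A, n + 2, by grind, by grind, hA, by grind, ?_⟩
      simp only [List.append_assoc, ticks_add] at hf
      simp [openAll, readSNF, tick, hv]
      simp [List.replicate] at hf
      rw [hf, Nat.add_comm 2 n]
    · obtain ⟨A, n, hl, hn, hA, hL, hf⟩ := ih (v :: F) (Function.update a v true)
          (tr ++ List.replicate 4 Event.tick)
      refine ⟨A ++ [v], n + 4, by grind, by grind, ?_, ?_, ?_⟩
      · intro w hw
        by_cases hwv : w = v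
        · simpa [hwv] using hv
        · have := hA w (by simpa [hwv] using hw)
          simpa [hwv] using this
      · intro w hw hw'
        by_cases hwv : w = v
        · simp [hwv]
        · simpa [hwv] using hL w (by simpa [hwv] using hw) (by simpa [hwv] using hw')
      · simp only [List.append_assoc, ticks_add] at hf
        simp [openAll, readSNF, tick, hv, writeSNF, pushF]
        simp [List.replicate] at hf
        rw [hf, Nat.add_comm 4 n]
        refine Prod.ext (by simp [Functor.map]) ?_
        simp [Functor.map]
        funext w
        by_cases hwv : w = v <;> simp [hwv]

end Loops

/-! ### The amortized analysis of `Enumerate` -/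

section Enumerate

variable {V : Type} [DecidableEq V]

/-- Besides the ticks, the effect of `expand` is to prepend new vertices `X` to `O.reverse ++ R`,
where `R` is the new `N` and `O` are the vertices opened for the recursive call. -/
theorem run_expand (k : ℕ) (adj : V → List V) (u : V) (hs : Bool) (m : Mem V) :
    ∃ (O R X : List V) (n : ℕ), X.length ≤ (adj u).length ∧ O.reverse ++ R = X ++ m.N ∧
      (k ≤ m.S.length → O = []) ∧ n ≤ 5 * (adj u).length + 2 + (if hs then 3 * O.length else 0) ∧
      (∀ v ∈ X, m.inSNF v = false) ∧
      (expand k adj u hs).run m = ((O.length, X.length),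
        { m with
          N := R
          F := O ++ m.F
          inSNF := fun v => if v ∈ X then true else m.inSNF v
          trace := m.trace ++ List.replicate n Event.tick }) := by
  by_cases hk : m.S.length < k
  · obtain ⟨A, B, n, hl, hn, hA, hf⟩ := run_scan (adj u) { m with trace := m.trace ++ [Event.tick] }
    cases hs with
    | false =>
      refine ⟨A, B ++ m.N, A.reverse ++ B, n + 1, by simpa using hl, by simp, by omega,
        by simp; omega, by simpa using hA, ?_⟩
      simp only [expand, run_bind, run_sizeS, hk, if_true, hf, Bool.false_eq_true, if_false, run_pure]
      simp [List.replicate_succ]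
    | true =>
      -- The move reverses `N`, and visiting the open vertices will reverse it back; so the old `N`
      -- reappears below `X`, and removing `|X|` vertices restores it.
      refine ⟨(B ++ m.N).reverse ++ A, [], A.reverse ++ B, n + 2 + 3 * (B ++ m.N).length,
        by simpa using hl, by simp, by omega, by simp; omega, by simpa using hA, ?_⟩
      have hmove := run_moveNToF (V := V)
        { m with
          N := B ++ m.N
          F := A ++ m.F
          inSNF := fun v => if v ∈ A ∨ v ∈ B then true else m.inSNF v
          trace := m.trace ++ [Event.tick] ++ List.replicate n Event.tick ++ [Event.tick] }
      simp only at hmove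
      simp only [expand, run_bind, run_sizeS, run_sizeN, hk, if_true, hf, hmove, run_pure]
      refine Prod.ext (Prod.ext (by simp; omega) (by simp)) ?_
      rw [show n + 2 + 3 * (B ++ m.N).length = 1 + (n + (1 + 3 * (B ++ m.N).length)) by ring]
      simp only [List.replicate_add]
      simp
  · refine ⟨[], m.N, [], 1, by simp, by simp, by simp, by omega, by simp, ?_⟩
    simp [expand, sizeS, tick, hk]
    rfl

/-- The outcome `(b, m')` of running `Enumerate` with `|S| = s`, open vertices `O` and further
elements `R` of `F` on the memory `m`. The last two fields bound the time since the last output. -/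
structure Explored (k K D s : ℕ) (O R : List V) (m : Mem V) (b : Bool) (m' : Mem V) : Prop where
  S_eq : m'.S = m.S
  N_eq : m'.N = O.reverse ++ m.N
  F_eq : m'.F = R
  inSNF_eq : m'.inSNF = m.inSNF
  worst_le : worst m'.trace ≤ D
  size_le : s + m'.T.length ≤ k
  of_true : b = true → lag m'.trace + K * s ≤ K * k + 3 * k + 10 + K * m'.T.length
  of_false : b = false → s + m'.T.length < k ∧ m.T.length + O.length ≤ m'.T.length ∧
    lag m'.trace + 3 * O.length + K * m.T.length ≤ lag m.trace + K * m'.T.length + 3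

/-- `call` behaves as `Enumerate` does when `|S| = s`. -/
def Explores (k Δ K E s : ℕ) (call : ℕ → Prog V Bool) : Prop :=
  ∀ (m : Mem V) (O R : List V), m.S.length = s → m.F = O ++ R → s + m.T.length ≤ k →
    m.N.length + O.length ≤ s * Δ → (s = k → O = []) → worst m.trace ≤ E + k + 3 →
    lag m.trace + 3 + K * k ≤ E + K * (s + m.T.length) →
    Explored k K (E + k + 3) s O R m ((call O.length).run m).1 ((call O.length).run m).2

/-- The outcome of the main loop of `Enumerate`, started with the flag `hs`. -/
structure Visited (k K D s : ℕ) (O R : List V) (m : Mem V) (hs b : Bool) (m' : Mem V) : Prop where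
  S_eq : m'.S = m.S
  N_eq : m'.N = O.reverse ++ m.N
  F_eq : m'.F = R
  inSNF_eq : m'.inSNF = m.inSNF
  worst_le : worst m'.trace ≤ D
  size_lt : s + m'.T.length < k
  of_true : b = true → lag m'.trace + K * s ≤ K * k + 3 * k + 10 + K * m'.T.length
  of_false : b = false → hs = false ∧ m.T.length + O.length ≤ m'.T.length ∧
    lag m'.trace + 3 * O.length + K * m.T.length ≤ lag m.trace + K * m'.T.length

/-- One iteration of the main loop of `Enumerate`, up to the next iteration in memory `m'`. -/
theorem visitOpen_step {k Δ K E s : ℕ} {adj : V → List V} {call : ℕ → Prog V Bool}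
    (hcall : Explores k Δ K E (s + 1) call) (hadj : ∀ v, (adj v).length ≤ Δ)
    (hK : 8 * Δ + 20 ≤ K) (hE : 2 * (K * k) + 3 * k + 3 * (k * Δ) + 10 ≤ E) (m : Mem V) (u : V)
    (F : List V) (hs : Bool) (ℓ : ℕ) (hS : m.S.length = s) (hF : m.F = u :: F)
    (hT : s + m.T.length < k) (hN : m.N.length ≤ s * Δ)
    (hw : worst m.trace ≤ E + k + 3)
    (hfalse : hs = false → lag m.trace + K * k ≤ E + K * (s + m.T.length))
    (htrue : hs = true → lag m.trace + K * s ≤ K * k + 3 * k + 10 + K * m.T.length) :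
    ∃ (b : Bool) (m' : Mem V), Visited k K (E + k + 3) s [u] F m hs (hs || b) m' ∧
      (visitOpen k adj call (ℓ + 1) hs).run m = (visitOpen k adj call ℓ (hs || b)).run m' := by
  obtain ⟨O, R, X, n, hX, hOR, hO, hn, hXf, hf⟩ := run_expand k adj u hs
    { m with
      S := u :: m.S
      F := F
      trace := m.trace ++ List.replicate 3 Event.tick }
  simp only at hOR hO hXf
  have hlen : O.length + R.length = X.length + m.N.length := by simpa using congrArg List.length hOR
  have hXΔ := hX.trans (hadj u)
  have hadju := hadj u
  have hsΔ : (s + 1) * Δ ≤ k * Δ := Nat.mul_le_mul_right _ (by omega)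
  -- The deadline for the call: if the flag is false, the `K` gained by enlarging `S` covers the
  -- scan; if it is true, the bound since the last output is used and the move adds at most `3 * (s
  -- + 1) * Δ`, whence the terms of `hE`.
  have hC := hcall
    { m with
      S := u :: m.S
      N := R
      F := O ++ F
      inSNF := fun v => if v ∈ X then true else m.inSNF v
      trace := m.trace ++ List.replicate 3 Event.tick ++ List.replicate n Event.tick } O F
    (by simp [hS]) rfl (by simp only; omega) (by simp only; rw [add_mul]; omega)
    (fun h => hO (by simp [hS, h])) (by simpa only [worst_append_ticks] using hw) (by
      simp only [lag_append_ticks]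
      rw [add_mul] at hsΔ
      have : K * (s + 1 + m.T.length) = K * s + K + K * m.T.length := by ring
      cases hs with
      | false =>
        have := hfalse rfl
        rw [mul_add] at this
        simp at hn
        omega
      | true =>
        have := htrue rfl
        simp at hn
        omega)
  set q := (call O.length).run
    { m with
      S := u :: m.S
      N := R
      F := O ++ F
      inSNF := fun v => if v ∈ X then true else m.inSNF v
      trace := m.trace ++ List.replicate 3 Event.tick ++ List.replicate n Event.tick } with hq
  obtain ⟨b, m3⟩ := q
  obtain ⟨h1, h2, h3, h4, h5, h6, h7, h8⟩ := hC
  simp only at h1 h2 h3 h4 h5 h6 h7 h8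
  rw [hOR] at h2
  have hdrop := run_dropN X (Y := m.N)
    { m3 with
      S := m.S
      T := if b then m3.T else u :: m3.T
      inT := if b then m3.inT else Function.update m3.inT u true
      trace := m3.trace ++ List.replicate (if b then 1 else 3) Event.tick } h2
  have hinSNF : (fun v => if v ∈ X then false else m3.inSNF v) = m.inSNF := by
    funext v
    rw [h4]
    by_cases hv : v ∈ X
    · simp [hv, hXf v hv]
    · simp [hv]
  simp only [hinSNF] at hdrop
  refine ⟨b, ⟨m.S, u :: m.N, F, if b then m3.T else u :: m3.T, m.inSNF,
    if b then m3.inT else Function.update m3.inT u true,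
    m3.trace ++ List.replicate ((if b then 1 else 3) + 3 * X.length + 1) Event.tick⟩, ?_, ?_⟩
  · refine ⟨rfl, rfl, rfl, rfl, by simpa using h5, ?_, ?_, ?_⟩
    · cases b with
      | false =>
        have := (h8 rfl).1
        simp only [Bool.false_eq_true, if_false, List.length_cons]
        omega
      | true =>
        simp only [if_true]
        omega
    · intro hb
      simp only [lag_append_ticks]
      cases b with
      | false =>
        -- The credit `3 * O.length` of the failed call cancels the cost of moving `N` to `F`.
        have h9 := h8 rfl
        simp only [lag_append_ticks] at h9
        obtain rfl : hs = true := by simpa using hb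
        have := htrue rfl
        simp only [if_true] at hn
        simp only [Bool.false_eq_true, if_false, List.length_cons]
        have : K * (m3.T.length + 1) = K * m3.T.length + K := by ring
        omega
      | true =>
        -- Returning from level `s + 1` to level `s` frees one `K`, enough for the cleanup of `3 *
        -- |X| + 2` units.
        have := h7 rfl
        rw [mul_add] at this
        simp only [if_true]
        omega
    · intro hb
      obtain ⟨rfl, rfl⟩ : hs = false ∧ b = false := by simpa using hb
      obtain ⟨h9, h10, h11⟩ := h8 rfl
      simp only [lag_append_ticks] at h11 ⊢
      simp only [Bool.false_eq_true, if_false, List.length_cons, List.length_nil] at hn ⊢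
      refine ⟨trivial, by omega, ?_⟩
      -- The vertex `u` itself joins `T`. Its `K` pays `5Δ + 5` before the call, the surplus 3 of
      -- the call, `3Δ + 4` after it, and the new credit 3: together `8Δ + 15`.
      have : K * (m3.T.length + 1) = K * m3.T.length + K := by ring
      omega
  · simp only [visitOpen, run_bind, run_tick, run_popF, hF, List.head?_cons, List.tail_cons,
      run_pushS]
    have h3t (tr : List (Event V)) : tr ++ [Event.tick] ++ [Event.tick] ++ [Event.tick] =
      tr ++ List.replicate 3 Event.tick := by simp
    simp only [h3t, hf, ← hq]
    cases b with
    | false =>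
      simp only [Bool.false_eq_true, if_false, h3] at hdrop
      simp only [Bool.false_eq_true, if_false, run_bind, run_pushT, run_writeT, run_popS, h1,
        List.tail_cons, h3t, hdrop, run_pushN, h3, List.replicate_add]
      simp
    | true =>
      simp only [if_true, List.replicate_one, h3] at hdrop
      simp only [if_true, run_bind, run_popS, h1, List.tail_cons, hdrop, run_pushN, h3,
        List.replicate_add]
      simp

/-- The main loop of `Enumerate`, when the recursive calls behave as expected. -/
theorem visitOpen_visited {k Δ K E s : ℕ} {adj : V → List V} {call : ℕ → Prog V Bool}
    (hcall : Explores k Δ K E (s + 1) call) (hadj : ∀ v, (adj v).length ≤ Δ)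
    (hK : 8 * Δ + 20 ≤ K) (hE : 2 * (K * k) + 3 * k + 3 * (k * Δ) + 10 ≤ E) (O R : List V)
    (m : Mem V) (hs : Bool) (hS : m.S.length = s) (hF : m.F = O ++ R)
    (hT : s + m.T.length < k) (hN : m.N.length + O.length ≤ s * Δ)
    (hw : worst m.trace ≤ E + k + 3)
    (hfalse : hs = false → lag m.trace + K * k ≤ E + K * (s + m.T.length))
    (htrue : hs = true → lag m.trace + K * s ≤ K * k + 3 * k + 10 + K * m.T.length) :
    Visited k K (E + k + 3) s O R m hs ((visitOpen k adj call O.length hs).run m).1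
      ((visitOpen k adj call O.length hs).run m).2 := by
  induction O generalizing m hs with
  | nil =>
    exact ⟨rfl, rfl, hF, rfl, hw, hT, htrue, fun h => ⟨h, le_rfl, le_rfl⟩⟩
  | cons u O ih =>
    rw [List.length_cons] at hN
    obtain ⟨b, m', h, hrun⟩ := visitOpen_step hcall hadj hK hE m u (O ++ R) hs O.length hS hF hT
      (by omega) hw hfalse htrue
    rw [List.length_cons, hrun]
    obtain ⟨h1, h2, h3, h4, h5, h6, h7, h8⟩ := h
    obtain ⟨g1, g2, g3, g4, g5, g6, g7, g8⟩ := ih m' (hs || b) (h1 ▸ hS) h3 h6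
      (by rw [h2]; simp; omega) h5
      (fun hb => by
        obtain ⟨h9, h10, h11⟩ := h8 hb
        have := hfalse h9
        rw [mul_add] at this ⊢
        omega) h7
    refine ⟨g1.trans h1, by simp [g2, h2], g3, g4.trans h4, g5, g6, g7, fun hb => ?_⟩
    obtain ⟨g9, g10, g11⟩ := g8 hb
    obtain ⟨h9, h10, h11⟩ := h8 g9
    simp only [List.length_cons, List.length_nil] at h10 h11 ⊢
    exact ⟨h9, by omega, by omega⟩

/-- Induction on `k - s`. The entry condition in `Explores` reserves `K` for each vertex by which
`|S| + |T|` still falls short of `k`; when nothing is missing, the clock is still below `E` and the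
output occurs. -/
theorem enumerate_explores {k Δ K E : ℕ} {adj : V → List V} (hadj : ∀ v, (adj v).length ≤ Δ)
    (hK : 8 * Δ + 20 ≤ K) (hE : 2 * (K * k) + 3 * k + 3 * (k * Δ) + 10 ≤ E) (depth s : ℕ)
    (hs : depth + s = k) : Explores k Δ K E s (enumerate k adj (depth + 1)) := by
  induction depth generalizing s with
  | zero =>
    intro m O R hS hF hT hN hO hw hlag
    obtain rfl : s = k := by omega
    obtain rfl := hO rfl
    have hT0 : m.T.length = 0 := by omega
    simp only [enumerate, run_bind, run_tick, run_sizeS, hS, if_true, run_get, run_output, run_pure]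
    rw [hT0] at hlag
    refine ⟨rfl, rfl, hF, rfl, ?_, hT, fun _ => ?_, fun h => by simp at h⟩
    · simp only [worst_append_output, worst_append_ticks, worst_append_tick, lag_append_tick,
        lag_append_ticks]
      have : K * (s + 0) = K * s := rfl
      omega
    · simp only [lag_append_output]
      omega
  | succ depth ih =>
    intro m O R hS hF hT hN hO hw hlag
    have hsk : s ≠ k := by omega
    have hcall := ih (s + 1) (by omega)
    rw [enumerate]
    simp only [run_bind, run_tick, run_sizeS, run_sizeT, hS, hsk, if_false]
    by_cases hst : s + m.T.length = k
    · obtain ⟨f, hdrop⟩ := run_dropT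
        { m with
          trace := m.trace ++ [Event.tick] ++ [Event.tick] ++ [Event.tick] ++
            List.replicate (m.S ++ m.T).length Event.tick ++ [Event.output (m.S ++ m.T)] }
      simp only at hdrop
      simp only [hst, if_true, run_bind, run_get, run_output, hdrop]
      -- Now `hlag` amounts to `lag m.trace + 3 ≤ E`; three operations and the writing of `k`
      -- vertices remain before the output.
      rw [hst] at hlag
      obtain ⟨g1, g2, g3, g4, g5, g6, g7, g8⟩ := visitOpen_visited hcall hadj hK hE O R
        { m with
          T := []
          inT := f
          trace := m.trace ++ [Event.tick] ++ [Event.tick] ++ [Event.tick] ++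
            List.replicate (m.S ++ m.T).length Event.tick ++ [Event.output (m.S ++ m.T)] ++
            List.replicate (3 * m.T.length) Event.tick }
        true hS hF (by simp only [List.length_nil]; omega) hN
        (by
          simp only [worst_append_output, worst_append_ticks, worst_append_tick, lag_append_tick,
            lag_append_ticks, List.length_append, hS]
          omega)
        (by simp)
        (fun _ => by
          have := Nat.mul_le_mul_left K (show s ≤ k by omega)
          simp only [lag_append_output, lag_append_ticks]
          omega)
      exact ⟨g1, g2, g3, g4, g5, by omega, g7, fun hb => by simpa using (g8 hb).1⟩
    · simp only [hst, if_false]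
      obtain ⟨g1, g2, g3, g4, g5, g6, g7, g8⟩ := visitOpen_visited hcall hadj hK hE O R
        { m with trace := m.trace ++ [Event.tick] ++ [Event.tick] ++ [Event.tick] }
        false hS hF (by simp only; omega) hN
        (by simpa only [worst_append_tick] using hw)
        (fun _ => by
          simp only [lag_append_tick]
          exact hlag)
        (by simp)
      refine ⟨g1, g2, g3, g4, g5, by omega, g7, fun hb => ?_⟩
      obtain ⟨-, h10, h11⟩ := g8 hb
      simp only [lag_append_tick] at h11
      exact ⟨g6, h10, by simp only at *; omega⟩

end Enumerate

/-! ### Depth-first orders -/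

theorem DFSReaches.mem_found {V : Type*} {G : SimpleGraph V} {stack found : List V}
    (h : DFSReaches G stack found) : ∀ v ∈ stack, v ∈ found := by
  induction h with
  | root r => simp
  | discover _ _ _ ih => simp_all
  | retreat _ _ ih => simp_all

theorem DFSReaches.nodup_found {V : Type*} {G : SimpleGraph V} {stack found : List V}
    (h : DFSReaches G stack found) : found.Nodup := by
  induction h with
  | root r => simp
  | discover _ _ hw ih => simpa [List.concat_eq_append] using List.Nodup.concat hw ih
  | retreat _ _ ih => exact ih

/-- Every vertex but the first has a neighbour that is discovered before it. -/
theorem DFSReaches.exists_adj_before {V : Type*} {G : SimpleGraph V} {stack found : List V}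
    (h : DFSReaches G stack found) {p q : List V} {v : V} (hf : found = p ++ v :: q)
    (hp : p ≠ []) : ∃ w ∈ p, G.Adj v w := by
  induction h generalizing p q v with
  | root r => cases p <;> simp_all
  | @discover u w stack found h hadj hw ih =>
    rcases List.eq_nil_or_concat q with rfl | ⟨q, x, rfl⟩
    · obtain ⟨rfl, h1⟩ := List.append_inj' hf rfl
      obtain rfl : w = v := by simpa using h1
      -- The witness is the parent in the search tree.
      exact ⟨u, h.mem_found u (by simp), hadj.symm⟩
    · rw [List.concat_eq_append, ← List.cons_append, ← List.append_assoc] at hf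
      exact ih (List.append_inj' hf rfl).1 hp
  | retreat _ _ ih => exact ih hf hp

/-! ### The amortized analysis of `Main` -/

section Main

variable {V : Type} [DecidableEq V]

/-- For `k = 1` the call outputs at once and leaves its open vertices on `F`, so the invariant
`Explored` fails. But every iteration produces an output, and a direct count suffices. -/
theorem mainLoop_worst_le_of_one {Δ : ℕ} {adj : V → List V} (hadj : ∀ v, (adj v).length ≤ Δ)
    (n : ℕ) (vs : List V) (m : Mem V) (hS : m.S = []) (hN : m.N = [])
    (hw : worst m.trace ≤ 4 * Δ + 30) (hlag : lag m.trace ≤ 20) :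
    worst ((mainLoop 1 n adj vs).run m).2.trace ≤ 4 * Δ + 30 := by
  induction vs generalizing m with
  | nil => exact hw
  | cons v vs ih =>
    obtain ⟨A, c, hA, hc, -, -, hopen⟩ := run_openAll (adj v)
      { m with
        S := [v]
        inSNF := Function.update m.inSNF v true
        trace := m.trace ++ [Event.tick] ++ [Event.tick] ++ [Event.tick] }
    have := hadj v
    simp only [hN] at hopen
    simp only [mainLoop, run_bind]
    split_ifs
    on_goal 2 => apply ih
    all_goals
      simp only [enumerate, run_bind, run_tick, run_pushS, run_writeSNF, hS, hopen, run_sizeS,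
        List.length_cons, List.length_nil, if_true, run_get, run_output, run_pure, run_pushF,
        run_popS, run_sizeN, hN, dropN, run_sizeF, List.tail_cons, zero_add, worst_append_tick,
        worst_append_output, worst_append_ticks, lag_append_tick, lag_append_ticks,
        lag_append_output]
    all_goals omega

/-- `T` survives from one iteration to the next, so failed iterations are charged to its growth. The
hypothesis `hback` makes that growth positive for every vertex but the last. -/
theorem mainLoop_worst_le {k Δ K E : ℕ} {adj : V → List V} (hk : 2 ≤ k)
    (hadj : ∀ v, (adj v).length ≤ Δ) (hK : 8 * Δ + 20 ≤ K)
    (hE : 3 * (K * k) + 3 * k + 3 * (k * Δ) + 10 ≤ E) (n : ℕ) (vs : List V) (m : Mem V)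
    (hnd : vs.Nodup) (hself : ∀ v, v ∉ adj v)
    (hback : ∀ p v q, vs = p ++ v :: q → q ≠ [] → ∃ w ∈ q, w ∈ adj v)
    (hS : m.S = []) (hN : m.N = []) (hSNF : ∀ v ∈ vs, m.inSNF v = false)
    (hT : 1 + m.T.length ≤ k) (hw : worst m.trace ≤ E + k + 3)
    (hlag : lag m.trace ≤ K * k + 3 * k + 10 + 2 * (K * m.T.length)) :
    worst ((mainLoop k n adj vs).run m).2.trace ≤ E + k + 3 := by
  induction vs generalizing m with
  | nil => exact hw
  | cons v vs ih =>
    obtain ⟨A, c, hA, hc, hAf, hAmem, hopen⟩ := run_openAll (adj v)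
      { m with
        S := [v]
        inSNF := Function.update m.inSNF v true
        trace := m.trace ++ [Event.tick] ++ [Event.tick] ++ [Event.tick] }
    simp only [hN] at hAf hAmem hopen
    have hΔ := hadj v
    have hexp := enumerate_explores (k := k) (E := E) hadj hK (by omega) (k - 1) 1 (by omega)
    rw [show k - 1 + 1 = k by omega] at hexp
    have hkΔ := Nat.mul_le_mul_right Δ hk
    -- The doubled term in `hlag` exceeds what the entry condition of `Explores` allows by `K *
    -- m.T.length`; this is the third `K * k` in `hE`.
    have hTk := Nat.mul_le_mul_left K (show m.T.length ≤ k by omega)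
    have hC := hexp
      { m with
        S := [v]
        F := A ++ m.F
        inSNF := fun w => if w ∈ A then true else Function.update m.inSNF v true w
        trace := m.trace ++ [Event.tick] ++ [Event.tick] ++ [Event.tick] ++
          List.replicate c Event.tick } A m.F rfl rfl hT
      (by simp only [hN, List.length_nil]; omega) (by omega)
      (by simpa only [worst_append_tick, worst_append_ticks] using hw)
      (by
        simp only [lag_append_tick, lag_append_ticks]
        rw [mul_add]
        omega)
    simp only [mainLoop, run_bind, run_tick, run_pushS, run_writeSNF, hS, hopen, hN] at hC ⊢
    set q := (enumerate k adj k A.length).run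
      { m with
        S := [v]
        N := []
        F := A ++ m.F
        inSNF := fun w => if w ∈ A then true else Function.update m.inSNF v true w
        trace := m.trace ++ [Event.tick] ++ [Event.tick] ++ [Event.tick] ++
          List.replicate c Event.tick } with hq
    obtain ⟨b, m3⟩ := q
    obtain ⟨h1, h2, h3, h4, h5, h6, h7, h8⟩ := hC
    simp only [List.append_nil, lag_append_tick, lag_append_ticks] at h1 h2 h3 h4 h5 h6 h7 h8
    have hdrop := run_dropN A.reverse (Y := [])
      { m3 with
        S := []
        F := v :: m3.F
        trace := m3.trace ++ [Event.tick] ++ [Event.tick] ++ [Event.tick] } (by simp [h2])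
    simp only [List.length_reverse] at hdrop
    simp only [run_pushF, run_popS, h1, List.tail_cons, run_sizeN, h2, List.length_reverse,
      run_sizeF]
    rw [h2] at hdrop
    simp only [hdrop]
    split_ifs
    · simpa only [run_pure, worst_append_tick, worst_append_ticks] using h5
    · cases vs with
      -- After the last vertex no output follows, so the clock needs no bound; this vertex may have
      -- no open neighbour.
      | nil => simpa only [mainLoop, run_pure, worst_append_tick, worst_append_ticks] using h5
      | cons w vs =>
        obtain ⟨x, hx, hxv⟩ := hback [] v (w :: vs) rfl (by simp)
        have hxne : x ≠ v := fun h => hself v (h ▸ hxv)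
        -- A vertex not yet visited is unmarked, so this neighbour is opened.
        have hxA := hAmem x hxv (by rw [Function.update_of_ne hxne]; exact hSNF x (by simp [hx]))
        have hApos := List.length_pos_of_mem hxA
        refine ih _ hnd.of_cons (fun p y q h => hback (v :: p) y q (by simp [h])) rfl rfl ?_ h6 ?_ ?_
        · intro y hy
          have hyv : y ≠ v := fun h => (List.nodup_cons.1 hnd).1 (h ▸ hy)
          by_cases hyA : y ∈ A
          · simp [hyA]
          · simpa [h4, hyA, hyv] using hSNF y (List.mem_cons_of_mem _ hy)
        · simpa only [worst_append_tick, worst_append_ticks] using h5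
        · simp only [lag_append_tick, lag_append_ticks]
          cases b with
          | false =>
            obtain ⟨-, h10, h11⟩ := h8 rfl
            -- Of the `2 * K` for each new element of `T`, one `K` was spent inside the call and the
            -- other covers the overhead of this iteration.
            have := Nat.mul_le_mul_left K (show m.T.length + 1 ≤ m3.T.length by omega)
            rw [mul_add] at this
            omega
          | true =>
            have := h7 rfl
            omega

end Main

end ConnEnum

theorem lemma2 :
    ∃ C : ℕ, ∀ (V : Type) [Fintype V] [DecidableEq V] [Nontrivial V]
      (G : SimpleGraph V) [DecidableRel G.Adj] (k : ℕ) (adj : V → List V) (order : List V),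
      G.Connected → 1 ≤ k →
      ConnEnum.IsAdjacencyLists G adj → ConnEnum.IsDFSOrder G order →
      ConnEnum.DelayAtMost (C * (k * G.maxDegree)) (ConnEnum.runTrace k adj order) := by
  -- With `K = 8Δ + 20` the bound `E + k + 3` equals `27kΔ + 64k + 13`, and `k ≤ kΔ`, `1 ≤ kΔ` give
  -- `27 + 64 + 13 = 104`.
  refine ⟨104, ?_⟩
  intro V _ _ _ G _ k adj order hG hk hadj hord
  apply ConnEnum.delayAtMost_of_worst_le
  have hΔ : ∀ v, (adj v).length ≤ G.maxDegree := by
    intro v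
    refine le_trans (le_of_eq ?_) (G.degree_le_maxDegree v)
    rw [← List.toFinset_card_of_nodup (hadj.nodup v), ← G.card_neighborFinset_eq_degree]
    congr 1
    ext w
    simp [hadj.mem_iff]
  have hpos : 1 ≤ G.maxDegree := by
    obtain ⟨v⟩ := hG.nonempty
    exact (hG.preconnected.degree_pos_of_nontrivial v).trans_le (G.degree_le_maxDegree v)
  obtain rfl | hk2 := hk.eq_or_lt
  · refine (ConnEnum.mainLoop_worst_le_of_one hΔ order.length order.reverse (ConnEnum.Mem.init V)
      rfl rfl (by simp [ConnEnum.Mem.init]) (by simp [ConnEnum.Mem.init])).trans ?_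
    omega
  · have hkΔ : k ≤ k * G.maxDegree := Nat.le_mul_of_pos_right k hpos
    refine (ConnEnum.mainLoop_worst_le (K := 8 * G.maxDegree + 20) hk2 hΔ le_rfl le_rfl
      order.length order.reverse (ConnEnum.Mem.init V) (List.nodup_reverse.2 hord.1.nodup_found)
      (fun v h => G.irrefl ((hadj.mem_iff v v).1 h)) ?_ rfl rfl (fun _ _ => rfl) hk
      (by simp [ConnEnum.Mem.init]) (by simp [ConnEnum.Mem.init])).trans ?_
    · intro p v q h hq
      obtain ⟨w, hw, hvw⟩ := hord.1.exists_adj_before (p := q.reverse) (q := p.reverse) (v := v)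
        (by rw [← order.reverse_reverse, h]; simp) (by simpa using hq)
      exact ⟨w, by simpa using hw, (hadj.mem_iff v w).2 hvw⟩
    · have : (8 * G.maxDegree + 20) * k = 8 * (k * G.maxDegree) + 20 * k := by ring
      omega
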